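/- All germs are smooth germs at the origin. Let $F:(\mathbb R^3,0)\to(\mathbb R^4,0)$ be a smooth map germ, parametrising $M^3_{\rm sing}$ at $p=0$. Two 2-jets are $\mathscr A^2$-equivalent if they agree after composing with germs of diffeomorphisms of $(\mathbb R^3,0)$ and $(\mathbb R^4,0)$. For a germ $f$ of corank 1 let $N_p=(\operatorname{im} df_0)^{\perp}$, $I(u,w)=\langle df_0u,df_0w\rangle$, $II(u,w)$ the orthogonal projection of $d^2f_0(u,w)$ to $N_p$, $C=\{u: I(u,u)=1\}$, $\Delta=\{II(u,u):u\in C\}$, and $u_\infty$ a unit vector with $I(u_\infty,u_\infty)=0$. An adapted frame (for germs in the two orbits below) is an orthonormal basis $\{v_a^1,v_a^2\}$ of $N_p$, positive for a chosen orientation of $N_p$, such that: if $II(u_\infty,u_\infty)\ne0$, then $v_a^1=II(u_\infty,u_\infty)/\|II(u_\infty,u_\infty)\|$; if $II(u_\infty,u_\infty)=0$, then $v_a^1,v_a^2$ point along the semi-major and semi-minor axes of $\Delta$ if $\Delta$ is a non-degenerate ellipse, $v_a^1$ is the direction of $\Delta$ if $\Delta$ is a segment, $v_a^2=y/\|y\|$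 if $\Delta=\{y\}$ with $y\neq0$, with no further condition if $\Delta=\{0\}$. The $i$-ary axial curvatures $\kappa_{a_i}^1,\kappa_{a_i}^2$ are the critical values of $w\mapsto\langle II(w,w),v_a^i\rangle$ on $C$ (a single critical value is counted twice). A Monge form is a smooth germ $f(x,y,z)=(x,y,f_1(x,y,z),f_2(x,y,z))$ with $f(0)=0$ and $df_1(0)=df_2(0)=0$; it is reduced if moreover $\partial_x\partial_zf_\ell(0)=\partial_y\partial_zf_\ell(0)=0$ for $\ell=1,2$. (1) Suppose that $j^2F(0)$ is $\mathscr A^2$-equivalent to $(x,y,z^2,0)$ or to $(x,y,0,0)$. Then there are a germ of diffeomorphism $h$ of $(\mathbb R^3,0)$ and a linear isometry $T$ of $\mathbb R^4$ such that $T\circ F\circ h$ is a reduced Monge form. For every such $h,T$, writing $f=T\circ F\circ h$, and for every adapted frame of $f$, the set of $i$-ary axial curvatures is of the form $\{\kappa_{a_i}^1,\kappa_{a_i}^2\}$ for $i=1,2$, and the Gaussian curvature at the origin of the regular surface $(x,y)\mapsto f(x,y,0)$ (with the induced metric) is $$K=\kappa_{a_1}^1\kappa_{a_1}^2+\kappa_{a_2}^1\kappa_{a_2}^2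 .$$ (2) In particular, suppose that $F$ is $\mathscr A$-equivalent to the frontal $(x,y,z^2,z^3)$ (cuspidal surface) or to the frontal $(x,y,z^2,yz^3)$ (cuspidal surface with a curve of cuspidal cross-caps). Then $j^2F(0)$ is $\mathscr A^2$-equivalent to $(x,y,z^2,0)$, and the conclusion on axial curvatures and $K$ in (1) holds for every Monge form $f=T\circ F\circ h$ ($h$ a germ of diffeomorphism, $T$ a linear isometry) whose singular set is $\{z=0\}$ near the origin, so that $f(x,y,0)$ parametrises the image of the singular set. -/

import Mathlib

open Filter Topology
open scoped ContDiff

noncomputable section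

namespace AxialCurvature

/-- Euclidean `n`-space. -/
abbrev E (n : ℕ) : Type := EuclideanSpace ℝ (Fin n)

/-- The `i`-th standard basis vector. -/
def e {n : ℕ} (i : Fin n) : E n := EuclideanSpace.single i (1 : ℝ)

/-! ### Germs at the origin, 2-jets and equivalence -/

/-- `h` represents a germ of a smooth diffeomorphism `(ℝⁿ, 0) → (ℝⁿ, 0)`
(local invertibility is expressed through the invertibility of the differential). -/
def IsDiffeoGerm {n : ℕ} (h : E n → E n) : Prop :=
  ContDiffAt ℝ ∞ h 0 ∧ h 0 = 0 ∧ (fderiv ℝ h 0).IsInvertible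

/-- The second differential at the origin. -/
def d2 (f : E 3 → E 4) (u w : E 3) : E 4 := fderiv ℝ (fderiv ℝ f) 0 u w

/-- `f` and `g` have the same 2-jet at the origin. -/
def SameJet2 (f g : E 3 → E 4) : Prop :=
  f 0 = g 0 ∧ fderiv ℝ f 0 = fderiv ℝ g 0 ∧
    fderiv ℝ (fderiv ℝ f) 0 = fderiv ℝ (fderiv ℝ g) 0

/-- The 2-jet of `f` at the origin lies in the `𝒜²`-orbit of the 2-jet of `g`. -/
def A2Equiv (f g : E 3 → E 4) : Prop :=
  ∃ (h : E 3 → E 3) (k : E 4 → E 4), IsDiffeoGerm h ∧ IsDiffeoGerm k ∧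
    SameJet2 (k ∘ f ∘ h) g

/-- The germs of `f` and `g` at the origin are `𝒜`-equivalent. -/
def AEquiv (f g : E 3 → E 4) : Prop :=
  ∃ (h : E 3 → E 3) (k : E 4 → E 4), IsDiffeoGerm h ∧ IsDiffeoGerm k ∧
    (k ∘ f ∘ h) =ᶠ[𝓝 0] g

/-- `(x, y, z) ↦ (x, y, z², 0)`. -/
def foldForm (u : E 3) : E 4 := !₂[u 0, u 1, u 2 ^ 2, 0]

/-- `(x, y, z) ↦ (x, y, 0, 0)`. -/
def flatForm (u : E 3) : E 4 := !₂[u 0, u 1, 0, 0]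

/-- Cuspidal surface: `(x, y, z) ↦ (x, y, z², z³)`. -/
def cuspidalForm (u : E 3) : E 4 := !₂[u 0, u 1, u 2 ^ 2, u 2 ^ 3]

/-- Cuspidal surface with a curve of cuspidal cross-caps: `(x, y, z) ↦ (x, y, z², y z³)`. -/
def cuspidalCrossCapForm (u : E 3) : E 4 := !₂[u 0, u 1, u 2 ^ 2, u 1 * u 2 ^ 3]

/-! ### Second order geometry of the germ at the origin -/

/-- Tangent space at `p = f 0`: the image of the differential. -/
def tangentSpace (f : E 3 → E 4) : Submodule ℝ (E 4) :=
  LinearMap.range (fderiv ℝ f 0 : E 3 →ₗ[ℝ] E 4)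

/-- Normal space at `p`. -/
abbrev normalSpace (f : E 3 → E 4) : Submodule ℝ (E 4) := (tangentSpace f)ᗮ

/-- First fundamental form (a pseudometric on the source tangent space). -/
def firstForm (f : E 3 → E 4) (u w : E 3) : ℝ :=
  inner ℝ (fderiv ℝ f 0 u) (fderiv ℝ f 0 w)

/-- Second fundamental form, with values in the normal space. -/
def secondForm (f : E 3 → E 4) (u w : E 3) : normalSpace f :=
  (normalSpace f).orthogonalProjectionOnto (d2 f u w)

/-- The set `C_q` of unit tangent vectors for the pseudometric. -/
def unitTangent (f : E 3 → E 4) : Set (E 3) := {u | firstForm f u u = 1}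

/-- The curvature locus `Δ_p`. -/
def curvatureLocus (f : E 3 → E 4) : Set (normalSpace f) :=
  (fun u => secondForm f u u) '' unitTangent f

/-- `u` is a null tangent direction `u_∞` (unique up to sign at a corank 1 point). -/
def IsNullDirection (f : E 3 → E 4) (u : E 3) : Prop :=
  ‖u‖ = 1 ∧ firstForm f u u = 0

/-- How the frame is chosen when `II(u_∞, u_∞) = 0` in the orbit `(x, y, 0, 0)`: the curvature
locus is a non-degenerate ellipse with semi-major axis along `v 0` and semi-minor axis along
`v 1`, or a segment in the direction `v 0`, or a point `y ≠ 0` with `v 1 = y / ‖y‖`, or the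
origin (and then there is no condition). -/
def LocusAdapted (f : E 3 → E 4) (v : Fin 2 → normalSpace f) : Prop :=
  (∃ (c : normalSpace f) (a b : ℝ), 0 < b ∧ b ≤ a ∧
    curvatureLocus f =
      Set.range fun t : ℝ => c + (a * Real.cos t) • v 0 + (b * Real.sin t) • v 1) ∨
  (∃ (c : normalSpace f) (a : ℝ), 0 < a ∧
    curvatureLocus f = (fun t : ℝ => c + t • v 0) '' Set.Icc (-a) a) ∨
  (∃ y : normalSpace f, y ≠ 0 ∧ curvatureLocus f = {y} ∧ v 1 = ‖y‖⁻¹ • y) ∨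
  curvatureLocus f = {0}

/-- `{v 0, v 1} = {v_a¹, v_a²}` is an adapted frame of the normal plane, positively oriented for
the orientation `o` of that plane. This covers the germs whose 2-jet is in the orbit of
`(x, y, z², 0)` (where `II(u_∞, u_∞) ≠ 0`) or of `(x, y, 0, 0)` (where it vanishes). -/
def IsAdaptedFrame (f : E 3 → E 4) (o : Orientation ℝ (normalSpace f) (Fin 2))
    (v : OrthonormalBasis (Fin 2) ℝ (normalSpace f)) : Prop :=
  v.toBasis.orientation = o ∧
  ∀ u : E 3, IsNullDirection f u →
    (secondForm f u u ≠ 0 → v 0 = ‖secondForm f u u‖⁻¹ • secondForm f u u) ∧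
    (secondForm f u u = 0 → LocusAdapted f v)

/-- The normal curvature function `K_ν(w) = ⟨II(w, w), ν⟩`. -/
def normalCurvature (f : E 3 → E 4) (ν : normalSpace f) (w : E 3) : ℝ :=
  inner ℝ (secondForm f w w) ν

/-- The axial curvatures in the direction `ν`: the critical values of `K_ν` restricted to `C_q`.
The tangent space of the regular level set `C_q = {I(w, w) = 1}` at `w` is the kernel of the
differential of `w ↦ I(w, w)`. -/
def axialCurvatures (f : E 3 → E 4) (ν : normalSpace f) : Set ℝ :=
  {κ | ∃ w ∈ unitTangent f,
    (∀ t : E 3, fderiv ℝ (fun u => firstForm f u u) w t = 0 →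
      fderiv ℝ (normalCurvature f ν) w t = 0) ∧
    normalCurvature f ν w = κ}

/-! ### Monge form -/

/-- `f` is a smooth germ in Monge form `(x, y, f₁, f₂)` with `f₁, f₂` of vanishing 1-jet. -/
structure IsMonge (f : E 3 → E 4) : Prop where
  smooth : ContDiffAt ℝ ∞ f 0
  map_zero : f 0 = 0
  graph : ∀ᶠ u in 𝓝 (0 : E 3), f u 0 = u 0 ∧ f u 1 = u 1
  fderiv_two : fderiv ℝ (fun u => f u 2) 0 = 0
  fderiv_three : fderiv ℝ (fun u => f u 3) 0 = 0

/-- Monge form whose 2-jet contains no `xz` and no `yz` terms. -/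
structure IsReducedMonge (f : E 3 → E 4) : Prop extends IsMonge f where
  d2_xz : d2 f (e 0) (e 2) = 0
  d2_yz : d2 f (e 1) (e 2) = 0

/-! ### Gaussian curvature of a parametrised surface -/

/-- The `i`-th partial derivative. -/
def partialD (i : Fin 2) (φ : E 2 → ℝ) (p : E 2) : ℝ := fderiv ℝ φ p (e i)

/-- The induced metric of the parametrised surface `s`. -/
def metric (s : E 2 → E 4) (p : E 2) : Matrix (Fin 2) (Fin 2) ℝ :=
  Matrix.of fun i j => inner ℝ (fderiv ℝ s p (e i)) (fderiv ℝ s p (e j))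

/-- The Christoffel symbol `Γᵏᵢⱼ` of the induced metric. -/
def christoffel (s : E 2 → E 4) (k i j : Fin 2) (p : E 2) : ℝ :=
  (1 / 2) * ∑ l, (metric s p)⁻¹ k l *
    (partialD i (fun x => metric s x j l) p + partialD j (fun x => metric s x i l) p
      - partialD l (fun x => metric s x i j) p)

/-- The curvature tensor: `R(∂ᵢ, ∂ⱼ) ∂ₖ = ∑ₗ (riemann s l k i j) ∂ₗ`. -/
def riemann (s : E 2 → E 4) (l k i j : Fin 2) (p : E 2) : ℝ :=
  partialD i (christoffel s l j k) p - partialD j (christoffel s l i k) p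
    + ∑ m, (christoffel s l i m p * christoffel s m j k p
      - christoffel s l j m p * christoffel s m i k p)

/-- The Gaussian curvature `⟨R(∂₁, ∂₂)∂₂, ∂₁⟩ / det g` of the induced metric. -/
def gaussianCurvature (s : E 2 → E 4) (p : E 2) : ℝ :=
  (∑ l, metric s p 0 l * riemann s l 1 0 1 p) / (metric s p).det

/-- The surface `(x, y) ↦ f(x, y, 0)`. -/
def regularSurface (f : E 3 → E 4) (p : E 2) : E 4 := f !₂[p 0, p 1, 0]

/-- For every adapted frame there are two primary axial curvatures `κ 0 0, κ 0 1` and two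
secondary ones `κ 1 0, κ 1 1` (a single critical value counts twice), and the Gaussian curvature
of `f(x, y, 0)` at the origin is `κ 0 0 * κ 0 1 + κ 1 0 * κ 1 1`. -/
def GaussianCurvatureFormula (f : E 3 → E 4) : Prop :=
  ∀ (o : Orientation ℝ (normalSpace f) (Fin 2))
    (v : OrthonormalBasis (Fin 2) ℝ (normalSpace f)), IsAdaptedFrame f o v →
    ∃ κ : Fin 2 → Fin 2 → ℝ,
      (∀ i, axialCurvatures f (v i) = {κ i 0, κ i 1}) ∧
      gaussianCurvature (regularSurface f) 0 = κ 0 0 * κ 0 1 + κ 1 0 * κ 1 1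

end AxialCurvature

end

/-! In Monge form the differential at the origin is `(x, y, 0, 0)`, so the metric of `f(x, y, 0)` is
the identity there and its second derivatives are already normal. The Gauss equation
(`gaussianCurvature_eq`) gives `K = ⟨II₀₀, II₁₁⟩ - ⟨II₀₁, II₀₁⟩`, which splits over an orthonormal
normal frame as a sum of terms `AC - B²`, one for each frame vector. In reduced form the normal
curvature on the cylinder `x² + y² = 1` is `Ax² + 2Bxy + Cy² + Dz²`. At a critical point the `z`
term contributes nothing and `(x, y)` is an eigenvector, so the critical values are the eigenvalues
of the `xy`-block, with product `AC - B²` (`exists_criticalValues`).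

A reduced form exists because of an invariant, `IsFoldAlong`: it holds for the normal forms and
passes back through changes of coordinates in source and target. It supplies the complement of the
kernel from which adapted coordinates are built (`IsFoldAlong.exists_isReducedMonge`). For frontals,
singularity along `z = 0` forces `f_z = 0` on that plane; differentiating along the plane removes
the `xz` and `yz` terms. -/

noncomputable section

namespace AxialCurvature

/-! ### Second order calculus -/

section Calculus

variable {X Y Z : Type*} [NormedAddCommGroup X] [NormedSpace ℝ X]
  [NormedAddCommGroup Y] [NormedSpace ℝ Y] [NormedAddCommGroup Z] [NormedSpace ℝ Z]

lemma eventually_contDiffAt {f : X → Y} {p : X} (hf : ContDiffAt ℝ ∞ f p) :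
    ∀ᶠ q in 𝓝 p, ContDiffAt ℝ 3 f q :=
  ContDiffAt.eventually (mod_cast contDiffAt_infty.1 hf 3) (by decide)

lemma differentiableAt_fderiv {f : X → Y} {p : X} (hf : ContDiffAt ℝ 3 f p) :
    DifferentiableAt ℝ (fderiv ℝ f) p :=
  (hf.fderiv_right (m := 2) (by norm_num)).differentiableAt (by norm_num)

/-- The second order chain rule. -/
lemma fderiv_fderiv_comp {g : Y → Z} {f : X → Y} {p : X} (hg : ContDiffAt ℝ ∞ g (f p))
    (hf : ContDiffAt ℝ ∞ f p) (u w : X) :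
    fderiv ℝ (fderiv ℝ (g ∘ f)) p u w =
      fderiv ℝ (fderiv ℝ g) (f p) (fderiv ℝ f p u) (fderiv ℝ f p w) +
        fderiv ℝ g (f p) (fderiv ℝ (fderiv ℝ f) p u w) := by
  have hev : fderiv ℝ (g ∘ f) =ᶠ[𝓝 p]
      fun q => (fderiv ℝ g (f q)).comp (fderiv ℝ f q) := by
    filter_upwards [eventually_contDiffAt hf,
      hf.continuousAt.eventually (eventually_contDiffAt hg)] with q hq hq'
    exact fderiv_comp q (hq'.differentiableAt (by norm_num)) (hq.differentiableAt (by norm_num))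
  have hf1 := (hf.differentiableAt (by simp)).hasFDerivAt
  have hf2 := (differentiableAt_fderiv (eventually_contDiffAt hf).self_of_nhds).hasFDerivAt
  have hg2 := (differentiableAt_fderiv (eventually_contDiffAt hg).self_of_nhds).hasFDerivAt
  have h := (HasFDerivAt.comp p hg2 hf1).clm_comp hf2
  simp only [Function.comp_def] at h
  rw [hev.fderiv_eq, h.fderiv]
  simp [add_comm]

lemma fderiv_fderiv_symm {f : X → Y} {p : X} (hf : ContDiffAt ℝ 3 f p) (u w : X) :
    fderiv ℝ (fderiv ℝ f) p u w = fderiv ℝ (fderiv ℝ f) p w u :=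
  ((hf.of_le (by norm_num) : ContDiffAt ℝ 2 f p).isSymmSndFDerivAt (by simp)).eq u w

lemma fderiv_fderiv_apply {f : X → Y} {p : X} (hf : ContDiffAt ℝ 3 f p) (u w : X) :
    fderiv ℝ (fun q => fderiv ℝ f q w) p u = fderiv ℝ (fderiv ℝ f) p u w := by
  rw [fderiv_clm_apply (differentiableAt_fderiv hf) (differentiableAt_const _)]
  simp

end Calculus

/-! ### Critical values of a quadratic form on a cylinder -/

section Quadratic

/-- The critical points, on the cylinder `x² + y² = 1`, of a quadratic form without `xz` and `yz`
terms have the eigenvalues of its restriction to the `xy`-plane as critical values. -/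
lemma exists_criticalValues (A B C D : ℝ) :
    ∃ k l : ℝ, k * l = A * C - B ^ 2 ∧
      {κ : ℝ | ∃ w : E 3, w 0 ^ 2 + w 1 ^ 2 = 1 ∧
        (∀ t : E 3, w 0 * t 0 + w 1 * t 1 = 0 →
          A * (w 0 * t 0) + B * (w 0 * t 1 + w 1 * t 0) + C * (w 1 * t 1) + D * (w 2 * t 2) = 0) ∧
        A * w 0 ^ 2 + 2 * B * (w 0 * w 1) + C * w 1 ^ 2 + D * w 2 ^ 2 = κ} = {k, l} := by
  -- `r` is the square root of the discriminant of the characteristic polynomial of the `xy`-block.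
  set r := Real.sqrt ((A - C) ^ 2 + 4 * B ^ 2) with hr
  have hr2 : r ^ 2 = (A - C) ^ 2 + 4 * B ^ 2 := Real.sq_sqrt (by positivity)
  have hroot : ∀ κ : ℝ, (A - κ) * (C - κ) = B ^ 2 ↔ κ = (A + C + r) / 2 ∨ κ = (A + C - r) / 2 := by
    intro κ
    have : (A - κ) * (C - κ) = B ^ 2 ↔ (κ - (A + C + r) / 2) * (κ - (A + C - r) / 2) = 0 := by
      constructor <;> intro h <;> linarith
    rw [this, mul_eq_zero, sub_eq_zero, sub_eq_zero]
  refine ⟨(A + C + r) / 2, (A + C - r) / 2, by linarith, ?_⟩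
  ext κ
  simp only [Set.mem_ofPred_eq, Set.mem_insert_iff, Set.mem_singleton_iff]
  rw [← hroot]
  constructor
  · rintro ⟨w, hw, hcrit, rfl⟩
    -- The tangent space of the cylinder is spanned by the axis and the rotation direction `(-y, x,
    -- 0)`; criticality is tested on each.
    have h2 : D * (w 2 * 1) = 0 := by simpa using hcrit !₂[0, 0, 1] (by simp)
    have h3 : A * (w 0 * (-w 1)) + B * (w 0 * w 0 + w 1 * (-w 1)) + C * (w 1 * w 0) = 0 := by
      simpa using hcrit !₂[-w 1, w 0, 0] (by simp; ring)
    have h4 : D * w 2 ^ 2 = 0 := by linear_combination w 2 * h2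
    rw [h4]
    generalize w 0 = x at *
    generalize w 1 = y at *
    -- The image of `(x, y)` under the block is orthogonal to `(-y, x)`, hence a multiple of `(x,
    -- y)`; the factor is the value of the form.
    have e1 : A * x + B * y = (A * x ^ 2 + 2 * B * (x * y) + C * y ^ 2 + 0) * x := by
      linear_combination (-y) * h3 - (A * x + B * y) * hw
    have e2 : B * x + C * y = (A * x ^ 2 + 2 * B * (x * y) + C * y ^ 2 + 0) * y := by
      linear_combination x * h3 - (B * x + C * y) * hw
    generalize A * x ^ 2 + 2 * B * (x * y) + C * y ^ 2 + 0 = κ at *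
    -- The adjugate of the block minus `κ`, applied to the eigenvector equations and paired with
    -- `(x, y)`, gives the determinant.
    linear_combination (-((A - κ) * (C - κ) - B ^ 2)) * hw +
      (x * (C - κ) - y * B) * e1 + (y * (A - κ) - x * B) * e2
  · intro h
    obtain ⟨x, y, hxy, e1, e2⟩ : ∃ x y : ℝ, x ^ 2 + y ^ 2 = 1 ∧ A * x + B * y = κ * x ∧
        B * x + C * y = κ * y := by
      have key : ∃ x y : ℝ, x ^ 2 + y ^ 2 ≠ 0 ∧ A * x + B * y = κ * x ∧
          B * x + C * y = κ * y := by
        -- `(B, κ - A)` solves the first row identically and the second by `h`; it vanishes exactly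
        -- in the excluded case.
        by_cases h0 : B = 0 ∧ κ = A
        · obtain ⟨rfl, rfl⟩ := h0
          exact ⟨1, 0, by norm_num, by ring, by ring⟩
        · refine ⟨B, κ - A, ?_, by ring, by linear_combination -h⟩
          intro hs
          refine h0 ⟨by nlinarith [sq_nonneg (κ - A)], ?_⟩
          have : (κ - A) = 0 := by nlinarith [sq_nonneg B]
          linarith
      obtain ⟨x, y, hne, e1, e2⟩ := key
      set n := Real.sqrt (x ^ 2 + y ^ 2)
      have hn2 : n ^ 2 = x ^ 2 + y ^ 2 := Real.sq_sqrt (by positivity)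
      have hn : n ≠ 0 := by
        intro h; rw [h] at hn2; exact hne (by linarith)
      refine ⟨x / n, y / n, ?_, ?_, ?_⟩
      · field_simp; linarith
      · field_simp; linarith
      · field_simp; linarith
    refine ⟨!₂[x, y, 0], by simpa using hxy, ?_, ?_⟩
    · intro t ht
      simp only [Matrix.cons_val] at ht ⊢
      linear_combination t 0 * e1 + t 1 * e2 + κ * ht
    · simp only [Matrix.cons_val]
      linear_combination x * e1 + y * e2 + κ * hxy

end Quadratic

/-! ### The Gauss equation for the induced metric -/

lemma partialD_metric {s : E 2 → E 4} {p : E 2} (hs : ContDiffAt ℝ 3 s p) (i j k : Fin 2) :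
    partialD k (fun x => metric s x i j) p =
      inner ℝ (fderiv ℝ s p (e i)) (fderiv ℝ (fderiv ℝ s) p (e k) (e j)) +
      inner ℝ (fderiv ℝ (fderiv ℝ s) p (e k) (e i)) (fderiv ℝ s p (e j)) := by
  have hd := differentiableAt_fderiv hs
  simp only [partialD, metric, Matrix.of_apply]
  rw [fderiv_inner_apply ℝ (by fun_prop) (by fun_prop), fderiv_fderiv_apply hs,
    fderiv_fderiv_apply hs]

/-- Expanding the metric derivatives, all but two equal terms cancel. The formula holds at every
nearby point, so it can be differentiated. -/
lemma christoffel_eq {s : E 2 → E 4} {p : E 2} (hs : ContDiffAt ℝ 3 s p) (k i j : Fin 2) :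
    christoffel s k i j p = ∑ l, (metric s p)⁻¹ k l *
      inner ℝ (fderiv ℝ (fderiv ℝ s) p (e i) (e j)) (fderiv ℝ s p (e l)) := by
  rw [christoffel, Finset.mul_sum]
  refine Finset.sum_congr rfl fun l _ => ?_
  rw [partialD_metric hs, partialD_metric hs, partialD_metric hs,
    fderiv_fderiv_symm hs (e j) (e i), fderiv_fderiv_symm hs (e l) (e i),
    fderiv_fderiv_symm hs (e l) (e j),
    real_inner_comm (fderiv ℝ s p (e j))]
  ring

lemma differentiableAt_metric {s : E 2 → E 4} {p : E 2} (hs : ContDiffAt ℝ 3 s p)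
    (i j : Fin 2) : DifferentiableAt ℝ (fun x => metric s x i j) p := by
  have hd := differentiableAt_fderiv hs
  simp only [metric, Matrix.of_apply]
  exact DifferentiableAt.inner ℝ (by fun_prop) (by fun_prop)

lemma differentiableAt_inv_metric {s : E 2 → E 4} {p : E 2} (hs : ContDiffAt ℝ 3 s p)
    (hdet : (metric s p).det ≠ 0) (i j : Fin 2) :
    DifferentiableAt ℝ (fun x => (metric s x)⁻¹ i j) p := by
  have h := differentiableAt_metric hs
  have h00 := h 0 0
  have h01 := h 0 1
  have h10 := h 1 0
  have h11 := h 1 1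
  have hdet' : DifferentiableAt ℝ (fun x => (metric s x).det) p := by
    simp only [Matrix.det_fin_two]
    fun_prop
  have hadj : DifferentiableAt ℝ (fun x => (metric s x).adjugate i j) p := by
    fin_cases i <;> fin_cases j <;> simp [Matrix.adjugate_fin_two] <;> fun_prop
  simp only [Matrix.inv_def, Ring.inverse_eq_inv', Matrix.smul_apply, smul_eq_mul]
  exact (hdet'.inv hdet).mul hadj

/-- The tangential products vanish at `p`, so the derivative of the inverse metric drops out, and
the identity metric keeps only the summand `l = k`. -/
lemma partialD_christoffel {s : E 2 → E 4} {p : E 2} (hs : ContDiffAt ℝ ∞ s p)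
    (hmetric : metric s p = 1)
    (hnormal : ∀ i j l : Fin 2,
      inner ℝ (fderiv ℝ (fderiv ℝ s) p (e i) (e j)) (fderiv ℝ s p (e l)) = 0)
    (k i j m : Fin 2) :
    partialD m (christoffel s k i j) p =
      inner ℝ (fderiv ℝ (fderiv ℝ s) p (e i) (e j)) (fderiv ℝ (fderiv ℝ s) p (e m) (e k)) +
      inner ℝ (fderiv ℝ (fun q => fderiv ℝ (fderiv ℝ s) q (e i) (e j)) p (e m))
        (fderiv ℝ s p (e k)) := by
  have hs3 := (eventually_contDiffAt hs).self_of_nhds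
  have hev : christoffel s k i j =ᶠ[𝓝 p] fun q => ∑ l, (metric s q)⁻¹ k l *
      inner ℝ (fderiv ℝ (fderiv ℝ s) q (e i) (e j)) (fderiv ℝ s q (e l)) := by
    filter_upwards [eventually_contDiffAt hs] with q hq using christoffel_eq hq k i j
  have hinv := differentiableAt_inv_metric hs3 (by simp [hmetric])
  have hd1 := differentiableAt_fderiv hs3
  have hd2 : DifferentiableAt ℝ (fderiv ℝ (fderiv ℝ s)) p :=
    ((hs3.fderiv_right (m := 2) (by norm_num)).fderiv_right (m := 1) (by norm_num)).differentiableAt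
      (by norm_num)
  have hi : ∀ l, DifferentiableAt ℝ (fun q =>
      (inner ℝ (fderiv ℝ (fderiv ℝ s) q (e i) (e j)) (fderiv ℝ s q (e l)) : ℝ)) p := fun l =>
    DifferentiableAt.inner ℝ (by fun_prop) (by fun_prop)
  rw [partialD, hev.fderiv_eq, fderiv_fun_sum fun l _ => (hinv k l).fun_mul (hi l)]
  simp only [sum_apply]
  rw [Finset.sum_eq_single k]
  · rw [fderiv_fun_mul (hinv k k) (hi k)]
    simp only [hnormal, hmetric, inv_one, Matrix.one_apply_eq, one_smul, zero_smul, add_zero]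
    rw [fderiv_inner_apply ℝ (by fun_prop) (by fun_prop), fderiv_fderiv_apply hs3]
  · intro l _ hl
    rw [fderiv_fun_mul (hinv k l) (hi l)]
    simp [hnormal, hmetric, Matrix.one_apply_ne hl.symm]
  · simp

/-- The Gauss equation at a point where the parametrisation is orthonormal and its second
derivatives are normal. -/
lemma gaussianCurvature_eq {s : E 2 → E 4} {p : E 2} (hs : ContDiffAt ℝ ∞ s p)
    (hmetric : metric s p = 1)
    (hnormal : ∀ i j l : Fin 2,
      inner ℝ (fderiv ℝ (fderiv ℝ s) p (e i) (e j)) (fderiv ℝ s p (e l)) = 0) :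
    gaussianCurvature s p =
      inner ℝ (fderiv ℝ (fderiv ℝ s) p (e 0) (e 0)) (fderiv ℝ (fderiv ℝ s) p (e 1) (e 1)) -
      inner ℝ (fderiv ℝ (fderiv ℝ s) p (e 0) (e 1)) (fderiv ℝ (fderiv ℝ s) p (e 0) (e 1)) := by
  have hs3 := (eventually_contDiffAt hs).self_of_nhds
  have hchr : ∀ k i j, christoffel s k i j p = 0 := fun k i j => by
    simp [christoffel_eq hs3, hnormal]
  -- The third derivatives of `s` in the Riemann tensor agree by symmetry of the second derivative
  -- of `∂₁s`, and so cancel.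
  have hthird : fderiv ℝ (fun q => fderiv ℝ (fderiv ℝ s) q (e 1) (e 1)) p (e 0) =
      fderiv ℝ (fun q => fderiv ℝ (fderiv ℝ s) q (e 0) (e 1)) p (e 1) := by
    have hg : ContDiffAt ℝ ∞ (fun q => fderiv ℝ s q (e 1)) p :=
      (hs.fderiv_right (m := ∞) le_rfl).clm_apply contDiffAt_const
    have hg3 := (eventually_contDiffAt hg).self_of_nhds
    have hev : ∀ i : Fin 2, (fun q => fderiv ℝ (fderiv ℝ s) q (e i) (e 1)) =ᶠ[𝓝 p]
        fun q => fderiv ℝ (fun q => fderiv ℝ s q (e 1)) q (e i) := fun i => by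
      filter_upwards [eventually_contDiffAt hs] with q hq using (fderiv_fderiv_apply hq _ _).symm
    rw [(hev 1).fderiv_eq, (hev 0).fderiv_eq, fderiv_fderiv_apply hg3, fderiv_fderiv_apply hg3,
      fderiv_fderiv_symm hg3]
  have hR : riemann s 0 1 0 1 p =
      inner ℝ (fderiv ℝ (fderiv ℝ s) p (e 0) (e 0)) (fderiv ℝ (fderiv ℝ s) p (e 1) (e 1)) -
      inner ℝ (fderiv ℝ (fderiv ℝ s) p (e 0) (e 1)) (fderiv ℝ (fderiv ℝ s) p (e 0) (e 1)) := by
    rw [riemann, partialD_christoffel hs hmetric hnormal, partialD_christoffel hs hmetric hnormal,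
      hthird, fderiv_fderiv_symm hs3 (e 1) (e 0),
      real_inner_comm (fderiv ℝ (fderiv ℝ s) p (e 0) (e 0))]
    simp only [hchr, mul_zero, sub_zero, Finset.sum_const_zero]
    ring
  rw [gaussianCurvature, hmetric, Fin.sum_univ_two, hR]
  simp

/-- The `i`-th coordinate function. -/
abbrev coord {n : ℕ} (i : Fin n) : E n →L[ℝ] ℝ := EuclideanSpace.proj i

lemma fderiv_coord {n m : ℕ} {f : E n → E m} {p : E n} (hf : DifferentiableAt ℝ f p) (w : E n)
    (i : Fin m) : fderiv ℝ (fun u => f u i) p w = fderiv ℝ f p w i := by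
  have h := (coord i).hasFDerivAt.comp p hf.hasFDerivAt
  exact congrArg (fun L : E n →L[ℝ] ℝ => L w) h.fderiv

lemma fderiv_proj {n : ℕ} (p w : E n) (i : Fin n) : fderiv ℝ (fun u : E n => u i) p w = w i :=
  congrArg (fun L : E n →L[ℝ] ℝ => L w) (coord i).fderiv

lemma eq_sum_coord (w : E 3) : w = w 0 • e 0 + w 1 • e 1 + w 2 • e 2 := by
  ext i
  fin_cases i <;> simp [e]

lemma d2_coord {f : E 3 → E 4} (hf : ContDiffAt ℝ 3 f 0) (u w : E 3) (i : Fin 4) :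
    d2 f u w i = fderiv ℝ (fun q => fderiv ℝ f q w i) 0 u := by
  have hd := differentiableAt_fderiv hf
  rw [fderiv_coord (f := fun q => fderiv ℝ f q w) (by fun_prop), fderiv_fderiv_apply hf]
  rfl

/-! ### Germs in Monge form -/

section Monge

variable {f : E 3 → E 4}

lemma IsMonge.contDiffAt_three (hf : IsMonge f) : ContDiffAt ℝ 3 f 0 :=
  (eventually_contDiffAt hf.smooth).self_of_nhds

lemma IsMonge.eventually_fderiv (hf : IsMonge f) :
    ∀ᶠ q in 𝓝 (0 : E 3), ∀ w, fderiv ℝ f q w 0 = w 0 ∧ fderiv ℝ f q w 1 = w 1 := by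
  filter_upwards [hf.graph.eventually_nhds, eventually_contDiffAt hf.smooth] with q hq hd w
  have hd' : DifferentiableAt ℝ f q := hd.differentiableAt (by norm_num)
  have h0 : (fun u => f u 0) =ᶠ[𝓝 q] fun u => u 0 := hq.mono fun u hu => hu.1
  have h1 : (fun u => f u 1) =ᶠ[𝓝 q] fun u => u 1 := hq.mono fun u hu => hu.2
  exact ⟨by rw [← fderiv_coord hd', h0.fderiv_eq, fderiv_proj],
    by rw [← fderiv_coord hd', h1.fderiv_eq, fderiv_proj]⟩

lemma IsMonge.fderiv_zero (hf : IsMonge f) (w : E 3) :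
    fderiv ℝ f 0 w = !₂[w 0, w 1, 0, 0] := by
  have hd : DifferentiableAt ℝ f 0 := hf.smooth.differentiableAt (by simp)
  have h := hf.eventually_fderiv.self_of_nhds w
  ext i
  fin_cases i
  · simpa using h.1
  · simpa using h.2
  · simpa [hf.fderiv_two] using (fderiv_coord hd w 2).symm
  · simpa [hf.fderiv_three] using (fderiv_coord hd w 3).symm

lemma IsMonge.d2_zero (hf : IsMonge f) (u w : E 3) : d2 f u w 0 = 0 := by
  have h : (fun q => fderiv ℝ f q w 0) =ᶠ[𝓝 0] fun _ => w 0 :=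
    hf.eventually_fderiv.mono fun q hq => (hq w).1
  rw [d2_coord hf.contDiffAt_three, h.fderiv_eq]
  simp

lemma IsMonge.d2_one (hf : IsMonge f) (u w : E 3) : d2 f u w 1 = 0 := by
  have h : (fun q => fderiv ℝ f q w 1) =ᶠ[𝓝 0] fun _ => w 1 :=
    hf.eventually_fderiv.mono fun q hq => (hq w).2
  rw [d2_coord hf.contDiffAt_three, h.fderiv_eq]
  simp

lemma IsMonge.inner_d2_fderiv (hf : IsMonge f) (u w t : E 3) :
    inner ℝ (d2 f u w) (fderiv ℝ f 0 t) = 0 := by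
  simp [hf.fderiv_zero, PiLp.inner_apply, Fin.sum_univ_four, hf.d2_zero, hf.d2_one]

/-- The first two coordinates of the second differential vanish, so it is already normal and the
projection fixes it. -/
lemma IsMonge.coe_secondForm (hf : IsMonge f) (u w : E 3) :
    (secondForm f u w : E 4) = d2 f u w := by
  have hmem : d2 f u w ∈ normalSpace f := by
    rw [Submodule.mem_orthogonal]
    rintro _ ⟨t, rfl⟩
    rw [real_inner_comm]
    exact hf.inner_d2_fderiv u w t
  exact congrArg Subtype.val
    ((normalSpace f).orthogonalProjectionOnto_mem_subspace_eq_self ⟨_, hmem⟩)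

lemma IsMonge.firstForm_eq (hf : IsMonge f) (u w : E 3) :
    firstForm f u w = u 0 * w 0 + u 1 * w 1 := by
  simp [firstForm, hf.fderiv_zero, PiLp.inner_apply, Fin.sum_univ_four]
  ring

lemma IsMonge.d2_symm (hf : IsMonge f) (u w : E 3) : d2 f u w = d2 f w u :=
  fderiv_fderiv_symm hf.contDiffAt_three u w

/-- Reducedness enters here: it decouples `z` from the `xy`-block. -/
lemma IsReducedMonge.d2_eq (hf : IsReducedMonge f) (w : E 3) :
    d2 f w w = w 0 ^ 2 • d2 f (e 0) (e 0) + (2 * (w 0 * w 1)) • d2 f (e 0) (e 1) +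
      w 1 ^ 2 • d2 f (e 1) (e 1) + w 2 ^ 2 • d2 f (e 2) (e 2) := by
  have h10 := hf.d2_symm (e 1) (e 0)
  have h02 := hf.d2_xz
  have h12 := hf.d2_yz
  have h20 := (hf.d2_symm (e 2) (e 0)).trans h02
  have h21 := (hf.d2_symm (e 2) (e 1)).trans h12
  conv_lhs => rw [eq_sum_coord w]
  simp only [d2] at *
  simp only [map_add, map_smul, add_apply, smul_apply,
    h10, h02, h12, h20, h21]
  module

lemma IsReducedMonge.normalCurvature_eq (hf : IsReducedMonge f) (ν : normalSpace f) (w : E 3) :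
    normalCurvature f ν w =
      inner ℝ (secondForm f (e 0) (e 0)) ν * w 0 ^ 2 +
      2 * inner ℝ (secondForm f (e 0) (e 1)) ν * (w 0 * w 1) +
      inner ℝ (secondForm f (e 1) (e 1)) ν * w 1 ^ 2 +
      inner ℝ (secondForm f (e 2) (e 2)) ν * w 2 ^ 2 := by
  simp only [normalCurvature, Submodule.coe_inner, hf.coe_secondForm]
  rw [hf.d2_eq w]
  simp only [inner_add_left, real_inner_smul_left]
  ring

lemma fderiv_quadratic (A B C D : ℝ) (w t : E 3) :
    fderiv ℝ (fun u : E 3 => A * u 0 ^ 2 + B * (u 0 * u 1) + C * u 1 ^ 2 + D * u 2 ^ 2) w t =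
      2 * A * (w 0 * t 0) + B * (w 0 * t 1 + w 1 * t 0) + 2 * C * (w 1 * t 1) +
        2 * D * (w 2 * t 2) := by
  have h : ∀ i : Fin 3, HasFDerivAt (fun u : E 3 => u i)
      (coord i) w := fun i =>
    (coord i).hasFDerivAt
  have hq := (((((h 0).pow 2).const_mul A).add (((h 0).mul (h 1)).const_mul B)).add
    (((h 1).pow 2).const_mul C)).add (((h 2).pow 2).const_mul D)
  have := congrArg (fun L : E 3 →L[ℝ] ℝ => L t) hq.fderiv
  refine this.trans ?_
  simp
  ring

lemma IsReducedMonge.exists_axialCurvatures (hf : IsReducedMonge f) (ν : normalSpace f) :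
    ∃ k l : ℝ, k * l =
      inner ℝ (secondForm f (e 0) (e 0)) ν * inner ℝ (secondForm f (e 1) (e 1)) ν -
        inner ℝ (secondForm f (e 0) (e 1)) ν ^ 2 ∧
      axialCurvatures f ν = {k, l} := by
  obtain ⟨k, l, hkl, hset⟩ := exists_criticalValues (inner ℝ (secondForm f (e 0) (e 0)) ν)
    (inner ℝ (secondForm f (e 0) (e 1)) ν) (inner ℝ (secondForm f (e 1) (e 1)) ν)
    (inner ℝ (secondForm f (e 2) (e 2)) ν)
  refine ⟨k, l, hkl, ?_⟩
  rw [← hset]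
  have hI : (fun u => firstForm f u u) =
      fun u : E 3 => 1 * u 0 ^ 2 + 0 * (u 0 * u 1) + 1 * u 1 ^ 2 + 0 * u 2 ^ 2 := by
    funext u
    rw [hf.firstForm_eq]
    ring
  have hN : normalCurvature f ν = _ := funext (hf.normalCurvature_eq ν)
  ext κ
  simp only [axialCurvatures, unitTangent, Set.mem_ofPred_eq]
  refine exists_congr fun w => and_congr ?_ (and_congr (forall_congr' fun t => ?_) ?_)
  · rw [hf.firstForm_eq]
    ring_nf
  · rw [hI, hN, fderiv_quadratic, fderiv_quadratic]
    refine imp_congr ?_ ?_ <;> constructor <;> intro h <;> linarith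
  · rw [hf.normalCurvature_eq]

/-- The inclusion of the plane `z = 0`. -/
def planeIncl : E 2 →L[ℝ] E 3 :=
  LinearMap.toContinuousLinearMap
    { toFun := fun p => !₂[p 0, p 1, 0]
      map_add' := fun p q => by ext i; fin_cases i <;> simp
      map_smul' := fun c p => by ext i; fin_cases i <;> simp }

lemma planeIncl_apply (p : E 2) : planeIncl p = !₂[p 0, p 1, 0] := rfl

lemma planeIncl_zero : planeIncl (e 0) = e 0 := by
  rw [planeIncl_apply]; ext i; fin_cases i <;> simp [e]

lemma planeIncl_one : planeIncl (e 1) = e 1 := by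
  rw [planeIncl_apply]; ext i; fin_cases i <;> simp [e]

lemma regularSurface_eq (f : E 3 → E 4) : regularSurface f = f ∘ planeIncl := rfl

lemma IsMonge.fderiv_regularSurface (hf : IsMonge f) (w : E 2) :
    fderiv ℝ (regularSurface f) 0 w = fderiv ℝ f 0 (planeIncl w) := by
  have hd : DifferentiableAt ℝ f (planeIncl 0) := by
    rw [planeIncl.map_zero]; exact hf.smooth.differentiableAt (by simp)
  rw [regularSurface_eq, fderiv_comp 0 hd planeIncl.differentiableAt]
  simp

lemma IsMonge.fderiv_fderiv_regularSurface (hf : IsMonge f) (u w : E 2) :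
    fderiv ℝ (fderiv ℝ (regularSurface f)) 0 u w = d2 f (planeIncl u) (planeIncl w) := by
  have hd : ContDiffAt ℝ ∞ f (planeIncl 0) := by
    rw [planeIncl.map_zero]; exact hf.smooth
  rw [regularSurface_eq, fderiv_fderiv_comp hd planeIncl.contDiff.contDiffAt]
  have h : fderiv ℝ (planeIncl : E 2 → E 3) = fun _ => planeIncl := by
    funext p; exact planeIncl.fderiv
  simp [h, d2]

lemma IsMonge.gaussianCurvature_eq (hf : IsMonge f) :
    gaussianCurvature (regularSurface f) 0 =
      inner ℝ (secondForm f (e 0) (e 0)) (secondForm f (e 1) (e 1)) -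
        inner ℝ (secondForm f (e 0) (e 1)) (secondForm f (e 0) (e 1)) := by
  have hs : ContDiffAt ℝ ∞ (regularSurface f) 0 := by
    rw [regularSurface_eq]
    refine ContDiffAt.comp (0 : E 2) ?_ planeIncl.contDiff.contDiffAt
    rw [planeIncl.map_zero]; exact hf.smooth
  rw [AxialCurvature.gaussianCurvature_eq hs]
  · simp only [hf.fderiv_fderiv_regularSurface, planeIncl_zero, planeIncl_one,
      Submodule.coe_inner, hf.coe_secondForm]
  · ext i j
    simp only [metric, Matrix.of_apply, hf.fderiv_regularSurface]
    refine (hf.firstForm_eq _ _).trans ?_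
    simp only [planeIncl_apply]
    fin_cases i <;> fin_cases j <;> simp [e]
  · intro i j l
    rw [hf.fderiv_fderiv_regularSurface, hf.fderiv_regularSurface, hf.inner_d2_fderiv]

theorem IsReducedMonge.gaussianCurvatureFormula (hf : IsReducedMonge f) :
    GaussianCurvatureFormula f := by
  intro o v _
  choose k l hkl hset using fun i => hf.exists_axialCurvatures (v i)
  refine ⟨fun i => ![k i, l i], fun i => by simpa using hset i, ?_⟩
  -- Parseval in the normal plane splits both inner products over the frame.
  rw [hf.gaussianCurvature_eq, ← v.sum_inner_mul_inner, ← v.sum_inner_mul_inner]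
  simp only [Matrix.cons_val_zero, Matrix.cons_val_one, hkl, Fin.sum_univ_two,
    real_inner_comm (v 0), real_inner_comm (v 1)]
  ring

/-- A Monge form that is singular along `z = 0` is reduced. -/
theorem IsMonge.isReducedMonge_of_singular (hf : IsMonge f)
    (hsing : ∀ᶠ u in 𝓝 (0 : E 3), u 2 = 0 → ¬ Function.Injective (fderiv ℝ f u)) :
    IsReducedMonge f := by
  have hz : ∀ᶠ u in 𝓝 (0 : E 3), u 2 = 0 → fderiv ℝ f u (e 2) = 0 := by
    filter_upwards [hsing, hf.eventually_fderiv] with u hu hfu h2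
    -- The first two coordinates of the differential near the origin are those of its argument, so
    -- any kernel vector is a multiple of `e 2`.
    obtain ⟨t, ht, ht0⟩ : ∃ t, fderiv ℝ f u t = 0 ∧ t ≠ 0 := by
      by_contra! h
      exact hu h2 ((injective_iff_map_eq_zero _).2 h)
    have h0 : t 0 = 0 := by rw [← (hfu t).1, ht]; rfl
    have h1 : t 1 = 0 := by rw [← (hfu t).2, ht]; rfl
    have hte : t = t 2 • e 2 := by
      conv_lhs => rw [eq_sum_coord t, h0, h1]
      simp
    have ht2 : t 2 ≠ 0 := fun h => ht0 (by rw [hte, h, zero_smul])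
    rw [hte, map_smul] at ht
    exact (smul_eq_zero.1 ht).resolve_left ht2
  -- The line through the origin along `w` stays in `z = 0`, where `f_z` vanishes; hence so does its
  -- derivative in that direction.
  have key : ∀ w : E 3, w 2 = 0 → d2 f w (e 2) = 0 := by
    intro w hw
    have hd := differentiableAt_fderiv hf.contDiffAt_three
    have hd' : DifferentiableAt ℝ (fun q => fderiv ℝ f q (e 2)) 0 := by fun_prop
    rw [d2, ← fderiv_fderiv_apply hf.contDiffAt_three, ← hd'.lineDeriv_eq_fderiv, lineDeriv]
    have hc : Tendsto (fun t : ℝ => (0 : E 3) + t • w) (𝓝 0) (𝓝 0) := by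
      have : Continuous fun t : ℝ => (0 : E 3) + t • w := by fun_prop
      simpa using this.tendsto 0
    have hev : (fun t : ℝ => fderiv ℝ f (0 + t • w) (e 2)) =ᶠ[𝓝 0] fun _ => 0 := by
      filter_upwards [hc.eventually hz] with t ht
      exact ht (by simp [hw])
    rw [hev.deriv_eq]
    simp
  exact ⟨hf, key _ (by simp [e]), key _ (by simp [e])⟩

end Monge

/-! ### Jets of the normal forms -/

section NormalForms

/-- A common family containing the four normal forms. -/
def cubicForm (a b c : ℝ) (u : E 3) : E 4 :=
  !₂[u 0, u 1, a * u 2 ^ 2, (b * u 1 + c) * u 2 ^ 3]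

lemma foldForm_eq : foldForm = cubicForm 1 0 0 := by
  funext u; simp [foldForm, cubicForm]

lemma flatForm_eq : flatForm = cubicForm 0 0 0 := by
  funext u; simp [flatForm, cubicForm]

lemma cuspidalForm_eq : cuspidalForm = cubicForm 1 0 1 := by
  funext u; simp [cuspidalForm, cubicForm]

lemma cuspidalCrossCapForm_eq : cuspidalCrossCapForm = cubicForm 1 1 0 := by
  funext u; simp [cuspidalCrossCapForm, cubicForm]

lemma contDiff_cubicForm (a b c : ℝ) : ContDiff ℝ ∞ (cubicForm a b c) := by
  rw [contDiff_euclidean]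
  intro i
  fin_cases i <;> simp [cubicForm] <;> fun_prop

lemma fderiv_cubicForm (a b c : ℝ) (q w : E 3) :
    fderiv ℝ (cubicForm a b c) q w = !₂[w 0, w 1, 2 * a * q 2 * w 2,
      b * w 1 * q 2 ^ 3 + 3 * (b * q 1 + c) * q 2 ^ 2 * w 2] := by
  have hd : DifferentiableAt ℝ (cubicForm a b c) q :=
    (contDiff_cubicForm a b c).differentiable (by simp) q
  have h : ∀ i : Fin 3, HasFDerivAt (fun u : E 3 => u i) (coord i) q := fun i =>
    (coord i).hasFDerivAt
  ext i
  rw [← fderiv_coord hd]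
  fin_cases i
  · exact fderiv_proj q w 0
  · exact fderiv_proj q w 1
  · refine (congrArg (fun L : E 3 →L[ℝ] ℝ => L w) (((h 2).pow 2).const_mul a).fderiv).trans ?_
    simp
    ring
  · refine (congrArg (fun L : E 3 →L[ℝ] ℝ => L w)
      ((((h 1).const_mul b).add_const c).mul ((h 2).pow 3)).fderiv).trans ?_
    simp
    ring

lemma d2_cubicForm (a b c : ℝ) (u w : E 3) :
    d2 (cubicForm a b c) u w = !₂[0, 0, 2 * a * u 2 * w 2, 0] := by
  have hd : ContDiffAt ℝ 3 (cubicForm a b c) 0 :=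
    (eventually_contDiffAt (contDiff_cubicForm a b c).contDiffAt).self_of_nhds
  have h : ∀ i : Fin 3, HasFDerivAt (fun u : E 3 => u i) (coord i) 0 := fun i =>
    (coord i).hasFDerivAt
  ext i
  rw [d2_coord hd]
  simp only [fderiv_cubicForm]
  fin_cases i
  · simp
  · simp
  · refine (congrArg (fun L : E 3 →L[ℝ] ℝ => L u)
      (((h 2).const_mul (2 * a)).mul_const (w 2)).fderiv).trans ?_
    simp
    ring
  · refine (congrArg (fun L : E 3 →L[ℝ] ℝ => L u)
      ((((h 2).pow 3).const_mul (b * w 1)).add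
        ((((((h 1).const_mul b).add_const c).const_mul 3).mul ((h 2).pow 2)).mul_const
          (w 2))).fderiv).trans ?_
    simp

/-- The last coordinate has order at least three, so `b` and `c` are invisible to the 2-jet. -/
lemma sameJet2_cubicForm (a b c b' c' : ℝ) : SameJet2 (cubicForm a b c) (cubicForm a b' c') := by
  refine ⟨by simp [cubicForm], ?_, ?_⟩
  · ext w : 1
    simp [fderiv_cubicForm]
  · ext u w : 2
    exact (d2_cubicForm a b c u w).trans (d2_cubicForm a b' c' u w).symm

lemma SameJet2.of_eventuallyEq {f g k : E 3 → E 4} (h : f =ᶠ[𝓝 0] g) (hg : SameJet2 g k) :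
    SameJet2 f k :=
  ⟨h.eq_of_nhds.trans hg.1, h.fderiv_eq.trans hg.2.1, h.fderiv.fderiv_eq.trans hg.2.2⟩

theorem AEquiv.a2Equiv {f g k : E 3 → E 4} (h : AEquiv f g) (hg : SameJet2 g k) :
    A2Equiv f k := by
  obtain ⟨φ, ψ, hφ, hψ, heq⟩ := h
  exact ⟨φ, ψ, hφ, hψ, SameJet2.of_eventuallyEq heq hg⟩

end NormalForms

/-! ### An invariant of the 2-jet under coordinate changes -/

section Fold

/-- The second intrinsic derivative `w ↦ d²f(u, w)` along the kernel `ℝ u` of `df` vanishes, modulo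
the image of `df`, on a complement `ker α` of the kernel. -/
def IsFoldAlong (f : E 3 → E 4) (u : E 3) (α : E 3 →L[ℝ] ℝ) : Prop :=
  α u = 1 ∧ fderiv ℝ f 0 u = 0 ∧ (∀ w, fderiv ℝ f 0 w = 0 → α w = 0 → w = 0) ∧
    ∀ w, α w = 0 → ∃ t, d2 f u w = fderiv ℝ f 0 t

lemma isFoldAlong_cubicForm (a b c : ℝ) : IsFoldAlong (cubicForm a b c) (e 2) (coord 2) := by
  refine ⟨by simp [e], ?_, ?_, ?_⟩
  · rw [fderiv_cubicForm]
    ext i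
    fin_cases i <;> simp [e]
  · intro w hw hw2
    rw [fderiv_cubicForm] at hw
    have h0 : w 0 = 0 := congrArg (fun v : E 4 => v 0) hw
    have h1 : w 1 = 0 := congrArg (fun v : E 4 => v 1) hw
    ext i
    fin_cases i
    · exact h0
    · exact h1
    · exact hw2
  · intro w hw
    have hw' : w 2 = 0 := hw
    refine ⟨0, ?_⟩
    rw [d2_cubicForm, map_zero, hw']
    ext i
    fin_cases i <;> simp

lemma IsFoldAlong.of_sameJet2 {f g : E 3 → E 4} {u : E 3} {α : E 3 →L[ℝ] ℝ}
    (hg : IsFoldAlong g u α) (h : SameJet2 f g) : IsFoldAlong f u α := by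
  simpa only [IsFoldAlong, d2, h.2.1, h.2.2] using hg

/-- The chain rule term with the second derivative of `k` contains `df u = 0`; what remains is the
image under the invertible `K`. -/
lemma IsFoldAlong.of_comp_left {f : E 3 → E 4} {k : E 4 → E 4} {u : E 3} {α : E 3 →L[ℝ] ℝ}
    (hk : IsDiffeoGerm k) (hf : ContDiffAt ℝ ∞ f 0) (hf0 : f 0 = 0)
    (h : IsFoldAlong (k ∘ f) u α) : IsFoldAlong f u α := by
  obtain ⟨hks, -, K, hK⟩ := hk
  have hks' : ContDiffAt ℝ ∞ k (f 0) := by rwa [hf0]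
  have h1 : ∀ w, fderiv ℝ (k ∘ f) 0 w = K (fderiv ℝ f 0 w) := fun w => by
    rw [fderiv_comp 0 (hks'.differentiableAt (by simp)) (hf.differentiableAt (by simp)), hf0, ← hK]
    rfl
  obtain ⟨hu, hker, hinj, him⟩ := h
  have hker' : fderiv ℝ f 0 u = 0 := by simpa [h1] using hker
  refine ⟨hu, hker', fun w hw => hinj w (by simp [h1, hw]), fun w hw => ?_⟩
  obtain ⟨t, ht⟩ := him w hw
  refine ⟨t, K.injective ?_⟩
  rw [d2, fderiv_fderiv_comp hks' hf, hker', h1, hf0, ← hK] at ht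
  simpa [d2] using ht

/-- The extra chain rule term is `df` of a second derivative of `h`, which lies in the image of
`df`. The kernel vector and the functional are carried over by the differential of `h`. -/
lemma IsFoldAlong.of_comp_right {f : E 3 → E 4} {h : E 3 → E 3} {u : E 3} {α : E 3 →L[ℝ] ℝ}
    (hh : IsDiffeoGerm h) (hf : ContDiffAt ℝ ∞ f 0) (hfold : IsFoldAlong (f ∘ h) u α) :
    ∃ u' α', IsFoldAlong f u' α' := by
  obtain ⟨hhs, hh0, H, hH⟩ := hh
  have hfs : ContDiffAt ℝ ∞ f (h 0) := by rwa [hh0]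
  have h1 : ∀ w, fderiv ℝ (f ∘ h) 0 w = fderiv ℝ f 0 (H w) := fun w => by
    rw [fderiv_comp 0 (hfs.differentiableAt (by simp)) (hhs.differentiableAt (by simp)), hh0, ← hH]
    rfl
  obtain ⟨hu, hker, hinj, him⟩ := hfold
  refine ⟨H u, α.comp (H.symm : E 3 →L[ℝ] E 3), by simpa using hu, by rw [← h1, hker], ?_, ?_⟩
  · intro w hw hαw
    have := hinj (H.symm w) (by simpa [h1] using hw) hαw
    simpa using this
  · intro w hw
    obtain ⟨t, ht⟩ := him (H.symm w) hw
    refine ⟨H t - fderiv ℝ (fderiv ℝ h) 0 u (H.symm w), ?_⟩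
    rw [d2, fderiv_fderiv_comp hfs hhs, h1, hh0, ← hH] at ht
    rw [map_sub, ← ht, d2]
    simp

theorem A2Equiv.exists_isFoldAlong {F : E 3 → E 4} (hF : ContDiffAt ℝ ∞ F 0) (hF0 : F 0 = 0)
    {a b c : ℝ} (h : A2Equiv F (cubicForm a b c)) : ∃ u α, IsFoldAlong F u α := by
  obtain ⟨φ, ψ, hφ, hψ, hjet⟩ := h
  have hFφ : ContDiffAt ℝ ∞ (F ∘ φ) 0 := ContDiffAt.comp 0 (by rwa [hφ.2.1]) hφ.1
  exact (((isFoldAlong_cubicForm a b c).of_sameJet2 hjet).of_comp_left hψ hFφ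
    (by simp [hφ.2.1, hF0])).of_comp_right hφ hF

end Fold

/-! ### Construction of a reduced Monge form -/

section Existence

lemma exists_isometry_of_finrank_eq_two {V : Submodule ℝ (E 4)} (hV : Module.finrank ℝ V = 2) :
    ∃ T : E 4 ≃ₗᵢ[ℝ] E 4, ∀ x ∈ V, T x 2 = 0 ∧ T x 3 = 0 := by
  let b : OrthonormalBasis (Fin 2) ℝ V := (stdOrthonormalBasis ℝ V).reindex (finCongr hV)
  -- The last two entries are placeholders: only indices `0` and `1` are prescribed before extending
  -- to a basis.
  let v : Fin 4 → E 4 := ![b 0, b 1, 0, 0]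
  have hb : ∀ i j : Fin 2, inner ℝ (b i : E 4) (b j) = if i = j then (1 : ℝ) else 0 := fun i j =>
    (orthonormal_iff_ite.1 b.orthonormal i j)
  have hv : Orthonormal ℝ (({0, 1} : Set (Fin 4)).domRestrict v) := by
    rw [orthonormal_iff_ite]
    rintro ⟨i, rfl | rfl⟩ ⟨j, rfl | rfl⟩
    · exact (hb 0 0).trans (by simp)
    · exact (hb 0 1).trans (by simp [Subtype.ext_iff])
    · exact (hb 1 0).trans (by simp [Subtype.ext_iff])
    · exact (hb 1 1).trans (by simp)
  obtain ⟨B, hB⟩ := hv.exists_orthonormalBasis_extension_of_card_eq (by simp)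
  have hB0 : B 0 = b 0 := hB 0 (by simp)
  have hB1 : B 1 = b 1 := hB 1 (by simp)
  refine ⟨B.repr, fun x hx => ?_⟩
  have hx' : x = (b.repr ⟨x, hx⟩ 0) • B 0 + (b.repr ⟨x, hx⟩ 1) • B 1 := by
    have := congrArg Subtype.val (b.sum_repr ⟨x, hx⟩)
    rw [Fin.sum_univ_two] at this
    rw [hB0, hB1]
    exact this.symm
  rw [hx']
  simp

lemma exists_localInverse {n : ℕ} {φ : E n → E n} (hφ : ContDiffAt ℝ ∞ φ 0) (hφ0 : φ 0 = 0)
    (hinj : ∀ w, fderiv ℝ φ 0 w = 0 → w = 0) :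
    ∃ h, IsDiffeoGerm h ∧ (∀ᶠ p in 𝓝 0, φ (h p) = p) ∧
      ∀ w, fderiv ℝ φ 0 (fderiv ℝ h 0 w) = w := by
  let L : E n ≃L[ℝ] E n := (LinearEquiv.ofInjectiveEndo (fderiv ℝ φ 0 : E n →ₗ[ℝ] E n)
    ((injective_iff_map_eq_zero _).2 hinj)).toContinuousLinearEquiv
  have hL : (L : E n →L[ℝ] E n) = fderiv ℝ φ 0 := by ext; rfl
  have hs : HasStrictFDerivAt φ (L : E n →L[ℝ] E n) 0 := by
    rw [hL]; exact hφ.hasStrictFDerivAt (by simp)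
  have hinv := hs.to_localInverse
  rw [hφ0] at hinv
  refine ⟨hs.localInverse φ L 0, ⟨?_, ?_, L.symm, hinv.hasFDerivAt.fderiv.symm⟩, ?_, ?_⟩
  · have := hφ.to_localInverse hs.hasFDerivAt (by simp)
    rwa [hφ0] at this
  · have := hs.localInverse_apply_image
    rwa [hφ0] at this
  · have := hs.eventually_right_inverse
    rwa [hφ0] at this
  · intro w
    rw [hinv.hasFDerivAt.fderiv, ← hL]
    simp

lemma IsFoldAlong.finrank_tangentSpace {f : E 3 → E 4} {u : E 3} {α : E 3 →L[ℝ] ℝ}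
    (h : IsFoldAlong f u α) : Module.finrank ℝ (tangentSpace f) = 2 := by
  obtain ⟨hu, hker, hinj, -⟩ := h
  have hk : Module.finrank ℝ (LinearMap.ker (fderiv ℝ f 0 : E 3 →ₗ[ℝ] E 4)) = 1 := by
    refine finrank_eq_one_iff'.2 ⟨⟨u, hker⟩, ?_, ?_⟩
    · intro h0
      have : u = 0 := congrArg Subtype.val h0
      simp [this] at hu
    · rintro ⟨w, hw⟩
      have hw' : fderiv ℝ f 0 w = 0 := hw
      refine ⟨α w, Subtype.ext ?_⟩
      have := hinj (w - α w • u) (by simp [hw', hker]) (by simp [hu])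
      exact (sub_eq_zero.1 this).symm
  have := LinearMap.finrank_range_add_finrank_ker (fderiv ℝ f 0 : E 3 →ₗ[ℝ] E 4)
  rw [hk, finrank_euclideanSpace_fin] at this
  exact Nat.add_right_cancel this

theorem IsFoldAlong.exists_isReducedMonge {F : E 3 → E 4} (hF : ContDiffAt ℝ ∞ F 0)
    (hF0 : F 0 = 0) {u : E 3} {α : E 3 →L[ℝ] ℝ} (hfold : IsFoldAlong F u α) :
    ∃ (h : E 3 → E 3) (T : E 4 ≃ₗᵢ[ℝ] E 4), IsDiffeoGerm h ∧ IsReducedMonge (T ∘ F ∘ h) := by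
  obtain ⟨T, hT⟩ := exists_isometry_of_finrank_eq_two hfold.finrank_tangentSpace
  have hT' : ∀ w, T (fderiv ℝ F 0 w) 2 = 0 ∧ T (fderiv ℝ F 0 w) 3 = 0 := fun w => hT _ ⟨w, rfl⟩
  obtain ⟨hu, hker, hinj, him⟩ := hfold
  have hTs : ContDiff ℝ ∞ T := T.contDiff
  have hTF : ContDiffAt ℝ ∞ (T ∘ F) 0 := hTs.contDiffAt.comp 0 hF
  have hdTF : ∀ w, fderiv ℝ (T ∘ F) 0 w = T (fderiv ℝ F 0 w) := fun w => by
    have := (T.toContinuousLinearEquiv.hasFDerivAt (x := F 0)).comp 0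
      (hF.differentiableAt (by simp)).hasFDerivAt
    exact congrArg (fun L : E 3 →L[ℝ] E 4 => L w) this.fderiv
  have hTF0 : T (F 0) = 0 := by simp [hF0]
  -- The inverse of these coordinates makes the first two components of `T ∘ F` equal to `x, y`,
  -- while `α` supplies `z`.
  let φ : E 3 → E 3 := fun p => !₂[T (F p) 0, T (F p) 1, α p]
  have hcoord : ∀ i : Fin 4, ContDiffAt ℝ ∞ (fun p => T (F p) i) 0 := fun i =>
    (coord i).contDiff.contDiffAt.comp 0 hTF
  have hφ : ContDiffAt ℝ ∞ φ 0 := by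
    rw [contDiffAt_euclidean]
    intro i
    fin_cases i
    · exact hcoord 0
    · exact hcoord 1
    · exact α.contDiff.contDiffAt
  have hφ0 : φ 0 = 0 := by
    ext i
    fin_cases i <;> simp [φ, hTF0]
  have hdφ : ∀ w, fderiv ℝ φ 0 w = !₂[T (fderiv ℝ F 0 w) 0, T (fderiv ℝ F 0 w) 1, α w] := by
    intro w
    have hd := hTF.differentiableAt (by simp)
    ext i
    rw [← fderiv_coord (hφ.differentiableAt (by simp))]
    fin_cases i
    · exact (fderiv_coord hd w 0).trans (by rw [hdTF]; rfl)
    · exact (fderiv_coord hd w 1).trans (by rw [hdTF]; rfl)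
    · exact congrArg (fun L : E 3 →L[ℝ] ℝ => L w) (α.fderiv (x := 0))
  obtain ⟨h, hh, hφh, hdφh⟩ := exists_localInverse hφ hφ0 (fun w hw => by
    rw [hdφ] at hw
    refine hinj w (T.injective ?_) (congrArg (fun v : E 3 => v 2) hw)
    rw [T.map_zero]
    ext i
    fin_cases i
    · exact congrArg (fun v : E 3 => v 0) hw
    · exact congrArg (fun v : E 3 => v 1) hw
    · exact (hT' w).1
    · exact (hT' w).2)
  have hTF' : ContDiffAt ℝ ∞ (T ∘ F) (h 0) := by rwa [hh.2.1]
  have hsmooth : ContDiffAt ℝ ∞ (T ∘ F ∘ h) 0 := hTF'.comp 0 hh.1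
  have hdf : ∀ w, fderiv ℝ (T ∘ F ∘ h) 0 w = T (fderiv ℝ F 0 (fderiv ℝ h 0 w)) := fun w => by
    have := fderiv_comp 0 (hTF'.differentiableAt (by simp)) (hh.1.differentiableAt (by simp))
    rw [hh.2.1] at this
    rw [← hdTF]
    exact congrArg (fun L : E 3 →L[ℝ] E 4 => L w) this
  have hmonge : IsMonge (T ∘ F ∘ h) := by
    refine ⟨hsmooth, by simp [hh.2.1, hF0], ?_, ?_, ?_⟩
    · filter_upwards [hφh] with p hp
      exact ⟨congrArg (fun v : E 3 => v 0) hp, congrArg (fun v : E 3 => v 1) hp⟩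
    · ext w
      rw [fderiv_coord (hsmooth.differentiableAt (by simp)), hdf]
      exact (hT' _).1
    · ext w
      rw [fderiv_coord (hsmooth.differentiableAt (by simp)), hdf]
      exact (hT' _).2
  have hα : ∀ w, α (fderiv ℝ h 0 w) = w 2 := fun w => by
    have := hdφh w
    rw [hdφ] at this
    exact congrArg (fun v : E 3 => v 2) this
  -- The kernel direction becomes the `z`-axis, because `dφ u = e 2`.
  have hhe : fderiv ℝ h 0 (e 2) = u := by
    have hdu : fderiv ℝ φ 0 u = e 2 := by
      rw [hdφ, hker, hu, T.map_zero]
      ext i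
      fin_cases i <;> simp [e]
    obtain ⟨H, hH⟩ := hh.2.2
    obtain ⟨w, rfl⟩ := H.surjective u
    have h3 : w = e 2 := by
      rw [← hdu]
      have := hdφh w
      rw [← hH] at this
      exact this.symm
    rw [← hH, h3]
    rfl
  have hred : ∀ w : E 3, w 2 = 0 → d2 (T ∘ F ∘ h) w (e 2) = 0 := by
    intro w hw
    -- A vector in `z = 0` is sent by `dh` into `ker α`, where the fold condition places the mixed
    -- second differential in the image of `dF`.
    obtain ⟨t, ht⟩ := him (fderiv ℝ h 0 w) (by rw [hα, hw])
    have hFh : ContDiffAt ℝ ∞ F (h 0) := by rwa [hh.2.1]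
    have hT2 : ∀ x, fderiv ℝ (fderiv ℝ T) x = 0 := by
      have : fderiv ℝ T = fun _ => (T.toContinuousLinearEquiv : E 4 →L[ℝ] E 4) := by
        funext x
        exact T.toContinuousLinearEquiv.fderiv
      rw [this]
      simp
    have hT1 : ∀ y x, fderiv ℝ T y x = T x := fun y x =>
      congrArg (fun L : E 4 →L[ℝ] E 4 => L x) T.toContinuousLinearEquiv.fderiv
    have hd2 : d2 (T ∘ F ∘ h) w (e 2) =
        T (fderiv ℝ F 0 (t + fderiv ℝ (fderiv ℝ h) 0 w (e 2))) := by
      rw [d2, fderiv_fderiv_comp hTs.contDiffAt (hFh.comp 0 hh.1), fderiv_fderiv_comp hFh hh.1]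
      simp only [Function.comp_apply, hT2, hT1, hh.2.1, hhe, map_add, ← ht]
      rw [fderiv_fderiv_symm (eventually_contDiffAt hF).self_of_nhds]
      simp [d2]
    -- The mixed derivative lies in `T` of the tangent plane, so its last two coordinates vanish;
    -- the first two vanish by the Monge form.
    have hc := hT' (t + fderiv ℝ (fderiv ℝ h) 0 w (e 2))
    rw [← hd2] at hc
    ext i
    fin_cases i
    · exact hmonge.d2_zero _ _
    · exact hmonge.d2_one _ _
    · exact hc.1
    · exact hc.2
  exact ⟨h, T, hh, hmonge, hred _ (by simp [e]), hred _ (by simp [e])⟩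

end Existence

end AxialCurvature

end

theorem mainTheorem4 (F : AxialCurvature.E 3 → AxialCurvature.E 4)
    (hF : ContDiffAt ℝ ∞ F 0) (hF0 : F 0 = 0) :
    ((AxialCurvature.A2Equiv F AxialCurvature.foldForm ∨
        AxialCurvature.A2Equiv F AxialCurvature.flatForm) →
      (∃ (h : AxialCurvature.E 3 → AxialCurvature.E 3)
          (T : AxialCurvature.E 4 ≃ₗᵢ[ℝ] AxialCurvature.E 4),
        AxialCurvature.IsDiffeoGerm h ∧ AxialCurvature.IsReducedMonge (T ∘ F ∘ h)) ∧
      ∀ (h : AxialCurvature.E 3 → AxialCurvature.E 3)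
          (T : AxialCurvature.E 4 ≃ₗᵢ[ℝ] AxialCurvature.E 4),
        AxialCurvature.IsDiffeoGerm h → AxialCurvature.IsReducedMonge (T ∘ F ∘ h) →
        AxialCurvature.GaussianCurvatureFormula (T ∘ F ∘ h)) ∧
    ((AxialCurvature.AEquiv F AxialCurvature.cuspidalForm ∨
        AxialCurvature.AEquiv F AxialCurvature.cuspidalCrossCapForm) →
      AxialCurvature.A2Equiv F AxialCurvature.foldForm ∧
      ∀ (h : AxialCurvature.E 3 → AxialCurvature.E 3)
          (T : AxialCurvature.E 4 ≃ₗᵢ[ℝ] AxialCurvature.E 4),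
        AxialCurvature.IsDiffeoGerm h → AxialCurvature.IsMonge (T ∘ F ∘ h) →
        (∀ᶠ u in 𝓝 (0 : AxialCurvature.E 3),
          ¬ Function.Injective (fderiv ℝ (T ∘ F ∘ h) u) ↔ u 2 = 0) →
        AxialCurvature.GaussianCurvatureFormula (T ∘ F ∘ h)) := by
  rw [AxialCurvature.foldForm_eq, AxialCurvature.flatForm_eq, AxialCurvature.cuspidalForm_eq,
    AxialCurvature.cuspidalCrossCapForm_eq]
  refine ⟨fun hA => ⟨?_, fun h T _ hred => hred.gaussianCurvatureFormula⟩, fun hA => ⟨?_, ?_⟩⟩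
  · obtain ⟨u, α, hfold⟩ : ∃ u α, AxialCurvature.IsFoldAlong F u α :=
      hA.elim (fun h => h.exists_isFoldAlong hF hF0) (fun h => h.exists_isFoldAlong hF hF0)
    exact hfold.exists_isReducedMonge hF hF0
  · exact hA.elim (fun h => h.a2Equiv (AxialCurvature.sameJet2_cubicForm _ _ _ _ _))
      (fun h => h.a2Equiv (AxialCurvature.sameJet2_cubicForm _ _ _ _ _))
  · intro h T _ hmonge hsing
    exact (hmonge.isReducedMonge_of_singular
      (hsing.mono fun u hu => hu.2)).gaussianCurvatureFormula
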